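/- Let $G=(V,E)$ be a finite bipartite (simple) graph in which every node $u\in V$ has a strict total order $>_u$ on the set of its neighbours (preference lists may be incomplete, i.e. $G$ need not be complete bipartite); $v>_u w$ means that $u$ prefers $v$ to $w$. A matching is a set $M\subseteq E$ such that every node is incident to at most one edge of $M$. A matching $M$ is stable if for every edge $uv\in E\setminus M$, either $u$ is matched in $M$ to a node $w$ with $w>_u v$, or $v$ is matched in $M$ to a node $w$ with $w>_v u$. Let $\chi(M)\in\{0,1\}^E$ be the incidence vector of $M$ and let $$P(G)=\operatorname{conv}\{\chi(M)\in\mathbb R^E : M \text{ is a stable matching in } G\}.$$ For $v\in V$ let $\delta(v)$ be the set of edges incident to $v$, for an edge $uv\in E$ let $\delta^{>u}(v)=\{vw\in E : w>_v u\}$, and for $x\in\mathbb R^E$ and $J\subseteq E$ put $x(J)=\sum_{e\in J}x_e$. Let $Q(G)$ be the set of all $x\in\mathbb R^E$ such that $$x(\delta(v))\le 1\ \ (v\in V),\qquad x_e\ge 0\ \ (e\in E),\qquad x(\delta^{>a}(b))+x(\delta^{>b}(a))+x_{ab}\ge 1\ \ (ab\in E).$$ Then $P(G)=Q(G)$, and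 every vertex (extreme point) of $Q(G)$ is integral, i.e. has only integer coordinates. -/

import Mathlib

/-- Strict preference lists on a graph `G`: each node `u` carries a strict total order `>_u` on its
set of neighbours. `prefers u v w` means `v >_u w`, that is, `u` prefers `v` to `w`; it is only
meaningful, and only ever used below, when `v` and `w` are neighbours of `u`. -/
structure PreferenceSystem {V : Type*} (G : SimpleGraph V) where
  prefers : V → V → V → Prop
  strictTotal : ∀ u : V,
    IsStrictTotalOrder (G.neighborSet u) (fun v w => prefers u (v : V) (w : V))

namespace PreferenceSystem

variable {V : Type*} {G : SimpleGraph V}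

/-- `M` is a matching: each node is incident to at most one edge in `M`. -/
def IsMatching (M : Set G.edgeSet) : Prop :=
  ∀ v : V, ∀ e ∈ M, ∀ f ∈ M, v ∈ (e : Sym2 V) → v ∈ (f : Sym2 V) → e = f

/-- `M(u) >_u v`: the node `u` is matched in `M`, to a node that it prefers to `v`. (An unmatched
node has `M(u) = ∅`, which is least preferred, so this fails then.) -/
def PartnerBetter (p : PreferenceSystem G) (M : Set G.edgeSet) (u v : V) : Prop :=
  ∃ (w : V) (h : G.Adj u w), (⟨s(u, w), h⟩ : G.edgeSet) ∈ M ∧ p.prefers u w v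

/-- `M` is a stable matching: for every edge `uv` not in `M`, `M(u) >_u v` or `M(v) >_v u`. -/
def IsStableMatching (p : PreferenceSystem G) (M : Set G.edgeSet) : Prop :=
  IsMatching M ∧
    ∀ (u v : V) (h : G.Adj u v), (⟨s(u, v), h⟩ : G.edgeSet) ∉ M →
      p.PartnerBetter M u v ∨ p.PartnerBetter M v u

/-- The incidence vector `χ(M) ∈ ℝ^E`. -/
noncomputable def incidenceVector (M : Set G.edgeSet) : G.edgeSet → ℝ :=
  M.indicator (fun _ => 1)

/-- The stable matching polytope `P(G)`. -/
def stableMatchingPolytope (p : PreferenceSystem G) : Set (G.edgeSet → ℝ) :=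
  convexHull ℝ {x | ∃ M : Set G.edgeSet, p.IsStableMatching M ∧ x = incidenceVector M}

/-- `δ(v)`: the edges incident to `v`. -/
def incidentEdges (v : V) : Set G.edgeSet :=
  {e | v ∈ (e : Sym2 V)}

/-- `δ^{>u}(v)`: the edges `vw` with `w >_v u`. -/
def betterEdges (p : PreferenceSystem G) (u v : V) : Set G.edgeSet :=
  {e | ∃ w : V, (e : Sym2 V) = s(v, w) ∧ p.prefers v w u}

open Classical in
/-- `x(J) = ∑_{e ∈ J} x_e` for a set `J` of edges of a finite graph. -/
noncomputable def edgeSum [Fintype V] (x : G.edgeSet → ℝ) (J : Set G.edgeSet) : ℝ :=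
  ∑ e : G.edgeSet with e ∈ J, x e

/-- The polytope `Q(G)`, given by the degree, nonnegativity and stability constraints. -/
def rothblumPolytope [Fintype V] (p : PreferenceSystem G) : Set (G.edgeSet → ℝ) :=
  {x | (∀ v : V, edgeSum x (incidentEdges v) ≤ 1) ∧ (∀ e : G.edgeSet, 0 ≤ x e) ∧
    ∀ (a b : V) (h : G.Adj a b),
      1 ≤ edgeSum x (p.betterEdges a b) + edgeSum x (p.betterEdges b a) + x ⟨s(a, b), h⟩}

end PreferenceSystem

/-!
Write `x(a > b)` for the total weight of the edges that `a` prefers to `ab`. Expanding squares along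
the preference lists, the sum over all ordered pairs `(a, b)` with `ab ∈ E` of
`x_ab * (x(a > b) + x(b > a) + x_ab)` equals `∑ v, x(δ(v)) ^ 2`. For `x ∈ Q(G)` each factor in
parentheses is at least `1` and `x(δ(v)) ^ 2 ≤ x(δ(v))`, so the stability constraint is tight at
every edge with `x_ab > 0`.

Let each node `a` of one side of the bipartition lay out its edges on `[0, 1)` from best to worst,
as consecutive intervals of lengths `x_ab`. By tightness, the reflection `θ ↦ 1 - θ` turns these
intervals into the ones that the nodes of the other side lay out from best to worst. Hence the edges
whose intervals contain a given `θ` form a stable matching. For `θ` uniform on `[0, 1)` the expected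
incidence vector of this matching is `x`, so `x` is in `P(G)`.
-/

section PrecedingSum

variable {α : Type*} [Fintype α] {r : α → α → Prop}

open scoped Classical in
/-- The sum of `f` over the elements that strictly precede `w` in the order `r`. Laying out weights
`f ≥ 0` consecutively in this order starts the interval of `w` at `precedingSum r f w`. -/
noncomputable def precedingSum {M : Type*} [AddCommMonoid M] (r : α → α → Prop) (f : α → M)
    (w : α) : M :=
  ∑ u with r u w, f u

section AddCommMonoid

variable {M : Type*} [AddCommMonoid M] [IsStrictTotalOrder α r]

lemma precedingSum_add_precedingSum_swap_add (f : α → M) (w : α) :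
    precedingSum r f w + precedingSum (Function.swap r) f w + f w = ∑ u, f u := by
  classical
  have hsplit (u : α) : f u =
      (if r u w then f u else 0) + (if r w u then f u else 0) + if u = w then f u else 0 := by
    rcases trichotomous_of r u w with h | rfl | h
    · simp [h, asymm_of r h, ne_of_irrefl h]
    · simp [irrefl_of r u]
    · simp [h, asymm_of r h, ne_of_irrefl' h]
  rw [Finset.sum_congr rfl fun u _ => hsplit u]
  simp [precedingSum, Function.swap, Finset.sum_add_distrib, Finset.sum_filter]

lemma precedingSum_eq_zero_or_exists_rel (f : α → M) (w : α) :
    precedingSum r f w = 0 ∨ ∃ u, r u w ∧ precedingSum r f w = precedingSum r f u + f u := by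
  classical
  rcases Set.eq_empty_or_nonempty {u | r u w} with hempty | hne
  · exact .inl <| Finset.sum_eq_zero fun u hu =>
      absurd (Finset.mem_filter.1 hu).2 (Set.eq_empty_iff_forall_notMem.1 hempty u)
  · have hwf : WellFounded (Function.swap r) := Finite.wellFounded_of_trans_of_irrefl _
    obtain ⟨u, hu, hmax⟩ := hwf.has_min _ hne
    have hpreceding : ({v | r v w} : Finset α) = insert u ({v | r v u} : Finset α) := by
      ext v
      simp only [Finset.mem_insert, Finset.mem_filter, Finset.mem_univ, true_and]
      refine ⟨fun hv => ?_, ?_⟩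
      · rcases trichotomous_of r v u with h | h | h
        · exact .inr h
        · exact .inl h
        · exact absurd h (hmax v hv)
      · rintro (rfl | hv)
        · exact hu
        · exact trans_of r hv hu
    refine .inr ⟨u, hu, ?_⟩
    rw [precedingSum, hpreceding, Finset.sum_insert (by simp [irrefl_of r u]), add_comm,
      precedingSum]

lemma exists_rel_not_precedingSum_and_precedingSum_add (f : α → M) {P : M → Prop} (h0 : ¬ P 0)
    {w : α} (hw : P (precedingSum r f w)) :
    ∃ u, r u w ∧ ¬ P (precedingSum r f u) ∧ P (precedingSum r f u + f u) := by
  have hwf : WellFounded r := Finite.wellFounded_of_trans_of_irrefl _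
  induction w using hwf.induction with
  | _ w ih =>
    rcases precedingSum_eq_zero_or_exists_rel (r := r) f w with h | ⟨u, hu, h⟩
    · exact absurd (h ▸ hw) h0
    · by_cases hPu : P (precedingSum r f u)
      · obtain ⟨t, ht, hPt⟩ := ih u hu hPu
        exact ⟨t, trans_of r ht hu, hPt⟩
      · exact ⟨u, hu, hPu, h ▸ hw⟩

end AddCommMonoid

section LinearOrder

variable {M : Type*} [AddCommMonoid M] [LinearOrder M] {f : α → M} {t : M}

lemma exists_rel_mem_Ico_precedingSum [IsStrictTotalOrder α r] (ht : 0 ≤ t) {w : α}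
    (hw : t < precedingSum r f w) :
    ∃ u, r u w ∧ t ∈ Set.Ico (precedingSum r f u) (precedingSum r f u + f u) := by
  simpa only [not_lt, Set.mem_Ico] using
    exists_rel_not_precedingSum_and_precedingSum_add f (P := (t < ·)) ht.not_gt hw

lemma exists_rel_mem_Ioc_precedingSum [IsStrictTotalOrder α r] (ht : 0 < t) {w : α}
    (hw : t ≤ precedingSum r f w) :
    ∃ u, r u w ∧ t ∈ Set.Ioc (precedingSum r f u) (precedingSum r f u + f u) := by
  simpa only [not_le, Set.mem_Ioc] using
    exists_rel_not_precedingSum_and_precedingSum_add f (P := (t ≤ ·)) ht.not_ge hw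

end LinearOrder

section OrderedAddCommMonoid

variable {M : Type*} [AddCommMonoid M] [PartialOrder M] [IsOrderedAddMonoid M] {f : α → M} {t : M}


lemma precedingSum_nonneg (hf : ∀ u, 0 ≤ f u) (w : α) : 0 ≤ precedingSum r f w :=
  Finset.sum_nonneg fun u _ => hf u

lemma precedingSum_add_le_of_rel [IsStrictOrder α r] (hf : ∀ u, 0 ≤ f u) {u w : α} (h : r u w) :
    precedingSum r f u + f u ≤ precedingSum r f w := by
  classical
  rw [precedingSum, add_comm, ← Finset.sum_insert (by simp [irrefl_of r u])]
  refine Finset.sum_le_sum_of_subset_of_nonneg (Finset.insert_subset (by simpa using h) ?_)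
    fun v _ _ => hf v
  exact Finset.monotone_filter_right _ fun v _ hv => trans_of r hv h

lemma precedingSum_add_le_sum [Std.Irrefl r] (hf : ∀ u, 0 ≤ f u) (w : α) :
    precedingSum r f w + f w ≤ ∑ u, f u := by
  classical
  rw [precedingSum, add_comm, ← Finset.sum_insert (by simp [irrefl_of r w])]
  exact Finset.sum_le_univ_sum_of_nonneg hf

lemma eq_of_mem_Ico_precedingSum [IsStrictTotalOrder α r] (hf : ∀ u, 0 ≤ f u) {u w : α}
    (hu : t ∈ Set.Ico (precedingSum r f u) (precedingSum r f u + f u))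
    (hw : t ∈ Set.Ico (precedingSum r f w) (precedingSum r f w + f w)) : u = w := by
  rcases trichotomous_of r u w with h | h | h
  · exact absurd ((precedingSum_add_le_of_rel hf h).trans hw.1) hu.2.not_ge
  · exact h
  · exact absurd ((precedingSum_add_le_of_rel hf h).trans hu.1) hw.2.not_ge

lemma eq_of_mem_Ioc_precedingSum [IsStrictTotalOrder α r] (hf : ∀ u, 0 ≤ f u) {u w : α}
    (hu : t ∈ Set.Ioc (precedingSum r f u) (precedingSum r f u + f u))
    (hw : t ∈ Set.Ioc (precedingSum r f w) (precedingSum r f w + f w)) : u = w := by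
  rcases trichotomous_of r u w with h | h | h
  · exact absurd (hu.2.trans (precedingSum_add_le_of_rel hf h)) hw.1.not_ge
  · exact h
  · exact absurd (hw.2.trans (precedingSum_add_le_of_rel hf h)) hu.1.not_ge

end OrderedAddCommMonoid

section CommSemiring

variable {R : Type*} [CommSemiring R]

lemma sum_mul_precedingSum_swap (f : α → R) :
    ∑ w, f w * precedingSum (Function.swap r) f w = ∑ w, f w * precedingSum r f w := by
  simp only [precedingSum, Finset.mul_sum, Finset.sum_filter, mul_ite, mul_zero]
  rw [Finset.sum_comm]
  simp only [Function.swap, mul_comm]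

lemma sum_mul_two_mul_precedingSum_add [IsStrictTotalOrder α r] (f : α → R) :
    ∑ w, f w * (2 * precedingSum r f w + f w) = (∑ w, f w) ^ 2 :=
  calc ∑ w, f w * (2 * precedingSum r f w + f w)
    _ = ∑ w, f w * (precedingSum r f w + precedingSum (Function.swap r) f w + f w) := by
      simp only [two_mul, mul_add, Finset.sum_add_distrib]
      rw [sum_mul_precedingSum_swap]
    _ = (∑ w, f w) ^ 2 := by
      simp only [precedingSum_add_precedingSum_swap_add, ← Finset.sum_mul, sq]

end CommSemiring

end PrecedingSum

namespace PreferenceSystem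

open MeasureTheory Set

variable {V : Type*} {G : SimpleGraph V}

section Edges

/-- The order `>_v`, as a relation on the neighbours of `v` only, where it is a strict total order;
`p.neighborPref v u w` means that `v` prefers `u` to `w`. -/
abbrev neighborPref (p : PreferenceSystem G) (v : V) (u w : G.neighborSet v) : Prop :=
  p.prefers v u w

instance (p : PreferenceSystem G) (v : V) :
    IsStrictTotalOrder (G.neighborSet v) (p.neighborPref v) :=
  p.strictTotal v

/-- The edge that joins `v` to one of its neighbours. Indexing the edges at `v` by neighbours makes
the order `>_v` available on them. -/
def edgeTo (v : V) (w : G.neighborSet v) : G.edgeSet := ⟨s(v, w), w.2⟩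

lemma edgeTo_injective (v : V) : Function.Injective (edgeTo (G := G) v) := fun _ _ h =>
  Subtype.ext (Sym2.congr_right.1 (congrArg Subtype.val h))

lemma edgeTo_swap {v : V} (w : G.neighborSet v) : edgeTo (w : V) ⟨v, w.2.symm⟩ = edgeTo v w :=
  Subtype.ext Sym2.eq_swap

lemma mem_edgeTo (v : V) (w : G.neighborSet v) : v ∈ (edgeTo v w : Sym2 V) :=
  Sym2.mem_mk_left _ _

lemma exists_edgeTo_eq {v : V} {e : G.edgeSet} (h : v ∈ (e : Sym2 V)) :
    ∃ w : G.neighborSet v, edgeTo v w = e := by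
  obtain ⟨w, hw⟩ := h
  exact ⟨⟨w, G.mem_edgeSet.1 (hw ▸ e.2)⟩, Subtype.ext hw.symm⟩

lemma edgeTo_mem_betterEdges (p : PreferenceSystem G) {a v : V} {w : G.neighborSet v} :
    edgeTo v w ∈ p.betterEdges a v ↔ p.prefers v w a := by
  refine ⟨?_, fun h => ⟨w, rfl, h⟩⟩
  rintro ⟨u, hu, h⟩
  rwa [(Sym2.congr_right.1 hu : (w : V) = u)]

lemma exists_mem_edgeTo_eq {A B : Set V} (hAB : G.IsBipartiteWith A B) (e : G.edgeSet) :
    ∃ a ∈ A, ∃ b : G.neighborSet a, edgeTo a b = e := by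
  obtain ⟨⟨u, v⟩, h⟩ := e
  rcases hAB.mem_of_adj h with ⟨hu, -⟩ | ⟨-, hv⟩
  · exact ⟨u, hu, ⟨v, h⟩, rfl⟩
  · exact ⟨v, hv, ⟨u, h.symm⟩, edgeTo_swap ⟨v, h⟩⟩

lemma incidenceVector_nonneg (M : Set G.edgeSet) (e : G.edgeSet) : 0 ≤ incidenceVector M e :=
  indicator_nonneg (fun _ _ => zero_le_one) e

lemma exists_int_eq_of_mem_extremePoints {p : PreferenceSystem G} {x : G.edgeSet → ℝ}
    (hx : x ∈ p.stableMatchingPolytope.extremePoints ℝ) (e : G.edgeSet) : ∃ n : ℤ, x e = n := by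
  obtain ⟨M, -, rfl⟩ := extremePoints_convexHull_subset hx
  by_cases he : e ∈ M
  · exact ⟨1, by simp [incidenceVector, he]⟩
  · exact ⟨0, by simp [incidenceVector, he]⟩

lemma isClosed_stableMatchingPolytope [Finite V] (p : PreferenceSystem G) :
    IsClosed p.stableMatchingPolytope := by
  classical
  refine Finite.isClosed_convexHull ℝ ((finite_range (incidenceVector (G := G))).subset ?_)
  rintro _ ⟨M, -, rfl⟩
  exact mem_range_self M

end Edges

variable [Fintype V]

section EdgeSum

lemma isLinearMap_edgeSum (J : Set G.edgeSet) :
    IsLinearMap ℝ fun x : G.edgeSet → ℝ => edgeSum x J where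
  map_add _ _ := Finset.sum_add_distrib
  map_smul c _ := (Finset.mul_sum _ _ c).symm

lemma edgeSum_nonneg {x : G.edgeSet → ℝ} (hx : ∀ e, 0 ≤ x e) (J : Set G.edgeSet) :
    0 ≤ edgeSum x J :=
  Finset.sum_nonneg fun e _ => hx e

lemma le_edgeSum {x : G.edgeSet → ℝ} (hx : ∀ e, 0 ≤ x e) {J : Set G.edgeSet} {e : G.edgeSet}
    (he : e ∈ J) : x e ≤ edgeSum x J := by
  classical
  exact Finset.single_le_sum (f := x) (fun e _ => hx e) (by simpa using he)

open scoped Classical in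
lemma edgeSum_eq_sum_neighborSet (x : G.edgeSet → ℝ) {v : V} {J : Set G.edgeSet}
    (hJ : ∀ e ∈ J, v ∈ (e : Sym2 V)) :
    edgeSum x J = ∑ w : G.neighborSet v with edgeTo v w ∈ J, x (edgeTo v w) := by
  have hmap : ({e | e ∈ J} : Finset G.edgeSet) =
      ({w | edgeTo v w ∈ J} : Finset (G.neighborSet v)).map ⟨edgeTo v, edgeTo_injective v⟩ := by
    ext e
    simp only [Finset.mem_map, Finset.mem_filter, Finset.mem_univ, true_and]
    refine ⟨fun he => ?_, ?_⟩
    · obtain ⟨w, rfl⟩ := exists_edgeTo_eq (hJ e he)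
      exact ⟨w, he, rfl⟩
    · rintro ⟨w, hw, rfl⟩
      exact hw
  rw [edgeSum, hmap, Finset.sum_map]
  rfl

open scoped Classical in
lemma edgeSum_incidentEdges (x : G.edgeSet → ℝ) (v : V) :
    edgeSum x (incidentEdges v) = ∑ w : G.neighborSet v, x (edgeTo v w) := by
  rw [edgeSum_eq_sum_neighborSet x (J := incidentEdges v) fun e he => he]
  exact Finset.sum_congr (Finset.filter_true_of_mem fun w _ => mem_edgeTo v w) fun _ _ => rfl

end EdgeSum

section StableMatchingPolytopeSubset

variable {p : PreferenceSystem G} {M : Set G.edgeSet}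

lemma convex_rothblumPolytope (p : PreferenceSystem G) : Convex ℝ p.rothblumPolytope := by
  simp only [rothblumPolytope, ofPred_and, ofPred_forall]
  exact .inter (convex_iInter fun v => convex_halfSpace_le (isLinearMap_edgeSum _) 1) <|
    .inter (convex_iInter fun e => convex_halfSpace_ge (LinearMap.proj e).isLinear 0) <|
    convex_iInter fun a => convex_iInter fun b => convex_iInter fun h => convex_halfSpace_ge
      ((isLinearMap_edgeSum (p.betterEdges a b)).mk' + (isLinearMap_edgeSum (p.betterEdges b a)).mk'
        + LinearMap.proj (⟨s(a, b), h⟩ : G.edgeSet)).isLinear 1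

lemma IsMatching.edgeSum_incidenceVector_le_one (hM : IsMatching M) (v : V) :
    edgeSum (incidenceVector M) (incidentEdges v) ≤ 1 := by
  classical
  simp only [edgeSum, incidenceVector, indicator_apply]
  rw [← Finset.sum_filter, Finset.sum_const, nsmul_one, Nat.cast_le_one, Finset.card_le_one]
  intro e he f hf
  simp only [Finset.mem_filter, Finset.mem_univ, true_and] at he hf
  exact hM v e he.2 f hf.2 he.1 hf.1

lemma PartnerBetter.one_le_edgeSum {u v : V} (h : p.PartnerBetter M u v) :
    1 ≤ edgeSum (incidenceVector M) (p.betterEdges v u) := by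
  obtain ⟨w, hw, hM, hpref⟩ := h
  have hone : incidenceVector M ⟨s(u, w), hw⟩ = 1 := indicator_of_mem hM _
  exact hone ▸ le_edgeSum (incidenceVector_nonneg M) ⟨w, rfl, hpref⟩

lemma IsStableMatching.incidenceVector_mem_rothblumPolytope (hM : p.IsStableMatching M) :
    incidenceVector M ∈ p.rothblumPolytope := by
  refine ⟨hM.1.edgeSum_incidenceVector_le_one, incidenceVector_nonneg M, fun a b h => ?_⟩
  have hab := edgeSum_nonneg (incidenceVector_nonneg M) (p.betterEdges a b)
  have hba := edgeSum_nonneg (incidenceVector_nonneg M) (p.betterEdges b a)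
  have he := incidenceVector_nonneg M ⟨s(a, b), h⟩
  by_cases hmem : (⟨s(a, b), h⟩ : G.edgeSet) ∈ M
  · have hone : incidenceVector M ⟨s(a, b), h⟩ = 1 := indicator_of_mem hmem _
    linarith
  · rcases hM.2 a b h hmem with hbetter | hbetter <;> linarith [hbetter.one_le_edgeSum]

lemma stableMatchingPolytope_subset_rothblumPolytope (p : PreferenceSystem G) :
    p.stableMatchingPolytope ⊆ p.rothblumPolytope := by
  refine convexHull_min ?_ (convex_rothblumPolytope p)
  rintro _ ⟨M, hM, rfl⟩
  exact hM.incidenceVector_mem_rothblumPolytope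

end StableMatchingPolytopeSubset

section Tightness

open scoped Classical in
/-- The total weight of the edges at `v` to neighbours that `v` prefers to `w`, which is
`x(δ^{>w}(v))`. -/
noncomputable def preferredWeight (p : PreferenceSystem G) (x : G.edgeSet → ℝ) (v : V)
    (w : G.neighborSet v) : ℝ :=
  precedingSum (p.neighborPref v) (fun u => x (edgeTo v u)) w

/-- The right-hand side of the stability constraint `1 ≤ …` at the edge `vw`, written with
`preferredWeight` so that it can be summed over the neighbours `w` of `v`. -/
noncomputable def stabilitySum (p : PreferenceSystem G) (x : G.edgeSet → ℝ) (v : V)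
    (w : G.neighborSet v) : ℝ :=
  p.preferredWeight x v w + p.preferredWeight x w ⟨v, w.2.symm⟩ + x (edgeTo v w)

variable {p : PreferenceSystem G} {x : G.edgeSet → ℝ}

lemma edgeSum_betterEdges (p : PreferenceSystem G) (x : G.edgeSet → ℝ) (v : V)
    (w : G.neighborSet v) : edgeSum x (p.betterEdges w v) = p.preferredWeight x v w := by
  classical
  have hincident : ∀ e ∈ p.betterEdges w v, v ∈ (e : Sym2 V) := by
    rintro e ⟨u, hu, -⟩
    exact hu ▸ Sym2.mem_mk_left _ _
  simp only [edgeSum_eq_sum_neighborSet x hincident, edgeTo_mem_betterEdges, preferredWeight,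
    precedingSum]

lemma one_le_stabilitySum (hx : x ∈ p.rothblumPolytope) (v : V) (w : G.neighborSet v) :
    1 ≤ p.stabilitySum x v w := by
  have h := hx.2.2 w v w.2.symm
  rwa [edgeSum_betterEdges p x v w, edgeSum_betterEdges p x w ⟨v, w.2.symm⟩,
    show (⟨s((w : V), v), w.2.symm⟩ : G.edgeSet) = edgeTo v w from edgeTo_swap w] at h

open scoped Classical in
lemma sum_edgeTo_le_one (hx : x ∈ p.rothblumPolytope) (v : V) :
    ∑ w : G.neighborSet v, x (edgeTo v w) ≤ 1 :=
  edgeSum_incidentEdges x v ▸ hx.1 v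

lemma sum_neighborSet_comm [∀ v, Fintype (G.neighborSet v)] {M : Type*} [AddCommMonoid M]
    (F : ∀ v, G.neighborSet v → M) :
    ∑ v, ∑ w : G.neighborSet v, F w ⟨v, w.2.symm⟩ = ∑ v, ∑ w : G.neighborSet v, F v w := by
  rw [Finset.sum_sigma', Finset.sum_sigma']
  refine Finset.sum_bij' (fun e _ => ⟨e.2, ⟨e.1, e.2.2.symm⟩⟩) (fun e _ => ⟨e.2, ⟨e.1, e.2.2.symm⟩⟩)
    ?_ ?_ ?_ ?_ ?_ <;> simp

open scoped Classical in
lemma sum_mul_stabilitySum (p : PreferenceSystem G) (x : G.edgeSet → ℝ) :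
    ∑ v, ∑ w : G.neighborSet v, x (edgeTo v w) * p.stabilitySum x v w =
      ∑ v, (∑ w : G.neighborSet v, x (edgeTo v w)) ^ 2 := by
  have hswap :
      ∑ v, ∑ w : G.neighborSet v, x (edgeTo v w) * p.preferredWeight x w ⟨v, w.2.symm⟩ =
        ∑ v, ∑ w : G.neighborSet v, x (edgeTo v w) * p.preferredWeight x v w := by
    rw [← sum_neighborSet_comm fun v w => x (edgeTo v w) * p.preferredWeight x v w]
    simp only [edgeTo_swap]
  have hsq (v : V) : (∑ w : G.neighborSet v, x (edgeTo v w)) ^ 2 =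
      ∑ w : G.neighborSet v, x (edgeTo v w) * (2 * p.preferredWeight x v w + x (edgeTo v w)) :=
    (sum_mul_two_mul_precedingSum_add (r := p.neighborPref v) _).symm
  simp only [hsq, stabilitySum, mul_add, two_mul, Finset.sum_add_distrib, hswap]

lemma mul_stabilitySum_eq (hx : x ∈ p.rothblumPolytope) (v : V) (w : G.neighborSet v) :
    x (edgeTo v w) * p.stabilitySum x v w = x (edgeTo v w) := by
  classical
  have hle (v : V) (w : G.neighborSet v) :
      x (edgeTo v w) ≤ x (edgeTo v w) * p.stabilitySum x v w :=
    le_mul_of_one_le_right (hx.2.1 _) (one_le_stabilitySum hx v w)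
  have hle_sum (v : V) : ∑ w, x (edgeTo v w) ≤ ∑ w, x (edgeTo v w) * p.stabilitySum x v w :=
    Finset.sum_le_sum fun w _ => hle v w
  have htotal : ∑ v, ∑ w : G.neighborSet v, x (edgeTo v w) =
      ∑ v, ∑ w : G.neighborSet v, x (edgeTo v w) * p.stabilitySum x v w := by
    refine (Finset.sum_le_sum fun v _ => hle_sum v).antisymm ?_
    rw [sum_mul_stabilitySum]
    exact Finset.sum_le_sum fun v _ => pow_le_of_le_one
      (Finset.sum_nonneg fun w _ => hx.2.1 _) (sum_edgeTo_le_one hx v) two_ne_zero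
  have hnode := (Finset.sum_eq_sum_iff_of_le fun v _ => hle_sum v).1 htotal v (Finset.mem_univ v)
  exact ((Finset.sum_eq_sum_iff_of_le fun w _ => hle v w).1 hnode w (Finset.mem_univ w)).symm

lemma stabilitySum_eq_one (hx : x ∈ p.rothblumPolytope) {v : V} {w : G.neighborSet v}
    (hpos : 0 < x (edgeTo v w)) : p.stabilitySum x v w = 1 :=
  (mul_eq_left₀ hpos.ne').1 (mul_stabilitySum_eq hx v w)

end Tightness

section ThresholdMatching

/-- The edges chosen at the threshold `θ`: each node `a ∈ A` lays out the weights of its edges on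
the unit interval from best to worst, and takes the edge whose interval contains `θ`. -/
def thresholdMatching (p : PreferenceSystem G) (A : Set V) (x : G.edgeSet → ℝ) (θ : ℝ) :
    Set G.edgeSet :=
  {e | ∃ a ∈ A, ∃ b : G.neighborSet a, edgeTo a b = e ∧
    θ ∈ Ico (p.preferredWeight x a b) (p.preferredWeight x a b + x (edgeTo a b))}

variable {p : PreferenceSystem G} {A B : Set V} {x : G.edgeSet → ℝ} {θ : ℝ}

lemma edgeTo_mem_thresholdMatching (hAB : G.IsBipartiteWith A B) {a : V} (ha : a ∈ A)
    (b : G.neighborSet a) : edgeTo a b ∈ p.thresholdMatching A x θ ↔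
      θ ∈ Ico (p.preferredWeight x a b) (p.preferredWeight x a b + x (edgeTo a b)) := by
  refine ⟨?_, fun h => ⟨a, ha, b, rfl, h⟩⟩
  rintro ⟨a', ha', b', he, hθ⟩
  have hb : (b : V) ∉ A := hAB.disjoint.notMem_of_mem_right (hAB.mem_of_mem_adj ha b.2)
  obtain rfl : a' = a := by
    rcases Sym2.eq_iff.1 (congrArg Subtype.val he) with ⟨h, -⟩ | ⟨h, -⟩
    · exact h
    · exact absurd (h ▸ ha') hb
  rwa [← edgeTo_injective _ he]

lemma edgeTo_mem_thresholdMatching_of_mem_right (hAB : G.IsBipartiteWith A B)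
    (hx : x ∈ p.rothblumPolytope) {b : V} (hb : b ∈ B) (a : G.neighborSet b) :
    edgeTo b a ∈ p.thresholdMatching A x θ ↔
      1 - θ ∈ Ioc (p.preferredWeight x b a) (p.preferredWeight x b a + x (edgeTo b a)) := by
  have ha : (a : V) ∈ A := hAB.mem_of_mem_adj' hb a.2.symm
  rw [← edgeTo_swap a, edgeTo_mem_thresholdMatching hAB ha, edgeTo_swap a, mem_Ico, mem_Ioc]
  rcases (hx.2.1 (edgeTo b a)).eq_or_lt with hzero | hpos
  · constructor <;> rintro ⟨hl, hr⟩ <;> linarith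
  · have htight := stabilitySum_eq_one hx hpos
    rw [stabilitySum] at htight
    constructor <;> rintro ⟨hl, hr⟩ <;> constructor <;> linarith

lemma isMatching_thresholdMatching (hAB : G.IsBipartiteWith A B) (hx : x ∈ p.rothblumPolytope) :
    IsMatching (p.thresholdMatching A x θ) := by
  classical
  intro v e he f hf hve hvf
  obtain ⟨u, rfl⟩ := exists_edgeTo_eq hve
  obtain ⟨w, rfl⟩ := exists_edgeTo_eq hvf
  rcases hAB.mem_of_adj u.2 with ⟨hv, -⟩ | ⟨hv, -⟩
  · rw [edgeTo_mem_thresholdMatching hAB hv] at he hf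
    exact congrArg _ (eq_of_mem_Ico_precedingSum (fun _ => hx.2.1 _) he hf)
  · rw [edgeTo_mem_thresholdMatching_of_mem_right hAB hx hv] at he hf
    exact congrArg _ (eq_of_mem_Ioc_precedingSum (fun _ => hx.2.1 _) he hf)

lemma partnerBetter_thresholdMatching_or (hAB : G.IsBipartiteWith A B)
    (hx : x ∈ p.rothblumPolytope) (hθ : θ ∈ Ico 0 1) {a : V} (ha : a ∈ A) (b : G.neighborSet a)
    (hM : edgeTo a b ∉ p.thresholdMatching A x θ) :
    p.PartnerBetter (p.thresholdMatching A x θ) a b ∨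
      p.PartnerBetter (p.thresholdMatching A x θ) b a := by
  classical
  have hb : (b : V) ∈ B := hAB.mem_of_mem_adj ha b.2
  rw [edgeTo_mem_thresholdMatching hAB ha, mem_Ico, not_and, not_lt] at hM
  rcases lt_or_ge θ (p.preferredWeight x a b) with hlt | hge
  · obtain ⟨u, hu, hmem⟩ := exists_rel_mem_Ico_precedingSum hθ.1 hlt
    exact .inl ⟨u, u.2, (edgeTo_mem_thresholdMatching hAB ha u).2 hmem, hu⟩
  · have hle : 1 - θ ≤ p.preferredWeight x b ⟨a, b.2.symm⟩ := by
      have hstable := one_le_stabilitySum hx a b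
      rw [stabilitySum] at hstable
      linarith [hM hge]
    obtain ⟨u, hu, hmem⟩ := exists_rel_mem_Ioc_precedingSum (sub_pos.2 hθ.2) hle
    exact .inr ⟨u, u.2, (edgeTo_mem_thresholdMatching_of_mem_right hAB hx hb u).2 hmem, hu⟩

lemma isStableMatching_thresholdMatching (hAB : G.IsBipartiteWith A B)
    (hx : x ∈ p.rothblumPolytope) (hθ : θ ∈ Ico 0 1) :
    p.IsStableMatching (p.thresholdMatching A x θ) := by
  refine ⟨isMatching_thresholdMatching hAB hx, fun u v h hM => ?_⟩
  rcases hAB.mem_of_adj h with ⟨hu, -⟩ | ⟨-, hv⟩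
  · exact partnerBetter_thresholdMatching_or hAB hx hθ hu ⟨v, h⟩ hM
  · refine (partnerBetter_thresholdMatching_or hAB hx hθ hv ⟨u, h.symm⟩ ?_).symm
    rwa [edgeTo_swap ⟨v, h⟩]

end ThresholdMatching

section RothblumPolytopeSubset

variable {p : PreferenceSystem G} {A B : Set V} {x : G.edgeSet → ℝ}

lemma incidenceVector_thresholdMatching (hAB : G.IsBipartiteWith A B) {a : V} (ha : a ∈ A)
    (b : G.neighborSet a) (θ : ℝ) :
    incidenceVector (p.thresholdMatching A x θ) (edgeTo a b) =
      (Ico (p.preferredWeight x a b) (p.preferredWeight x a b + x (edgeTo a b))).indicator 1 θ := by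
  classical
  simp only [incidenceVector, indicator_apply, edgeTo_mem_thresholdMatching hAB ha, Pi.one_apply]

lemma integrable_incidenceVector_thresholdMatching (hAB : G.IsBipartiteWith A B) (e : G.edgeSet)
    (μ : Measure ℝ) [IsFiniteMeasure μ] :
    Integrable (fun θ => incidenceVector (p.thresholdMatching A x θ) e) μ := by
  obtain ⟨a, ha, b, rfl⟩ := exists_mem_edgeTo_eq hAB e
  simp only [incidenceVector_thresholdMatching hAB ha]
  exact (integrable_const 1).indicator measurableSet_Ico

lemma Ico_preferredWeight_subset (hx : x ∈ p.rothblumPolytope) (v : V) (w : G.neighborSet v) :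
    Ico (p.preferredWeight x v w) (p.preferredWeight x v w + x (edgeTo v w)) ⊆ Ico 0 1 := by
  classical
  exact Ico_subset_Ico (precedingSum_nonneg (fun _ => hx.2.1 _) w)
    ((precedingSum_add_le_sum (fun _ => hx.2.1 _) w).trans (sum_edgeTo_le_one hx v))

lemma integral_incidenceVector_thresholdMatching (hAB : G.IsBipartiteWith A B)
    (hx : x ∈ p.rothblumPolytope) (e : G.edgeSet) :
    ∫ θ in Ico (0 : ℝ) 1, incidenceVector (p.thresholdMatching A x θ) e = x e := by
  obtain ⟨a, ha, b, rfl⟩ := exists_mem_edgeTo_eq hAB e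
  simp only [incidenceVector_thresholdMatching hAB ha]
  rw [integral_indicator_one measurableSet_Ico, measureReal_restrict_apply measurableSet_Ico,
    inter_eq_left.2 (Ico_preferredWeight_subset hx a b),
    Real.volume_real_Ico_of_le (le_add_of_nonneg_right (hx.2.1 _)), add_sub_cancel_left]

lemma rothblumPolytope_subset_stableMatchingPolytope (hAB : G.IsBipartiteWith A B) :
    p.rothblumPolytope ⊆ p.stableMatchingPolytope := by
  classical
  intro x hx
  have : IsProbabilityMeasure (volume.restrict (Ico (0 : ℝ) 1)) := ⟨by simp⟩
  have hint := integrable_incidenceVector_thresholdMatching (p := p) (x := x) hAB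
    (μ := volume.restrict (Ico (0 : ℝ) 1))
  have hmean : ∫ θ in Ico (0 : ℝ) 1, incidenceVector (p.thresholdMatching A x θ) = x := by
    ext e
    rw [eval_integral hint, integral_incidenceVector_thresholdMatching hAB hx]
  rw [← hmean]
  refine (convex_convexHull ℝ _).integral_mem (isClosed_stableMatchingPolytope p) ?_
    (Integrable.of_eval hint)
  filter_upwards [ae_restrict_mem measurableSet_Ico] with θ hθ
  exact subset_convexHull ℝ _ ⟨_, isStableMatching_thresholdMatching hAB hx hθ, rfl⟩

end RothblumPolytopeSubset

end PreferenceSystem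

theorem mainTheorem1 {V : Type*} [Fintype V] (G : SimpleGraph V) (hG : G.IsBipartite)
    (p : PreferenceSystem G) :
    p.stableMatchingPolytope = p.rothblumPolytope ∧
      ∀ x ∈ p.rothblumPolytope.extremePoints ℝ, ∀ e : G.edgeSet, ∃ n : ℤ, x e = n := by
  obtain ⟨A, B, hAB⟩ := hG.exists_isBipartiteWith
  have hPQ : p.stableMatchingPolytope = p.rothblumPolytope :=
    p.stableMatchingPolytope_subset_rothblumPolytope.antisymm
      (PreferenceSystem.rothblumPolytope_subset_stableMatchingPolytope hAB)
  exact ⟨hPQ, fun x hx e => PreferenceSystem.exists_int_eq_of_mem_extremePoints (hPQ ▸ hx) e⟩
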